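/- Fix a choice of sign: $\varepsilon\in\{1,-1\}$. For integers $m\ge 1$, $n\ge 0$ put $A=18(m+24n)-\varepsilon$, $B=\tfrac{4}{9}\varepsilon$, $D=-3$, $r=\tfrac13+A^2$, and let $E_{m,n}=E_{m,n}^{\varepsilon}$ be the curve over $\mathbb{Q}$ $$y^2+xy=x^3+H(m,n)\,x+J(m,n),$$ $$H(m,n)=\tfrac1{16}\bigl(2ABD+2A^2Dr+3r^2\bigr),\qquad J(m,n)=\tfrac1{64}\bigl(B^2D+2ABDr+A^2Dr^2+r^3\bigr).$$ For $m\in\{1,2,5,7,8,10,11,13,14,16,17,19,22,23\}$ define the integer $\delta_m(n)=\delta_m^{\varepsilon}(n)$ by $$2(m+24n)\bigl(62208n^2+(5184m-432\varepsilon)n+(108m^2-18\varepsilon m+1)\bigr)=2^{i}\,\delta_m(n),$$ where $i=1$ if $m$ is odd, $i=4$ if $m\in\{8,16\}$, and $i=2$ for the other even $m$. **Proposition.** Let $\varepsilon\in\{1,-1\}$ and let $m$ be one of the $14$ values above. Then there are infinitely many positive integers $n$ such that $\delta_m(n)$ is squarefree. Moreover, for every integer $n\ge 0$ such that $\delta_m(n)$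 is squarefree, $E_{m,n}$ is an elliptic curve over $\mathbb{Q}$ with the following properties: 1. $E_{m,n}=C/\langle P\rangle$ for some elliptic curve $C/\mathbb{Q}$ with a rational point $P$ of order $3$; that is, there is an isogeny $C\to E_{m,n}$ defined over $\mathbb{Q}$ with kernel $\langle P\rangle$. 2. $E_{m,n}/\mathbb{Q}$ is semistable: at every prime its reduction is good or multiplicative. 3. $E_{m,n}$ has good reduction at $3$. 4. At every prime $v$ of bad reduction, $3\nmid \operatorname{ord}_v(\Delta_{E_{m,n}})$, where $\Delta_{E_{m,n}}$ is the minimal discriminant. -/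

import Mathlib

open WeierstrassCurve

noncomputable section

namespace ThreeIsogeny

/-! ### Morphisms of projective Weierstrass curves and quotients by cyclic subgroups -/

/-- An algebraic closure of `ℚ`. -/
abbrev QBar : Type := AlgebraicClosure ℚ

/-- The points of a Weierstrass curve `W` over `ℚ` with coordinates in `QBar`. -/
abbrev GeomPoint (W : WeierstrassCurve ℚ) : Type := (W.baseChange QBar).toAffine.Point

/-- The points of a Weierstrass curve `W` over `ℚ` with rational coordinates. -/
abbrev RatPoint (W : WeierstrassCurve ℚ) : Type := (W.baseChange ℚ).toAffine.Point

/-- Homogeneous coordinates in the projective plane: `O = [0 : 1 : 0]` and `(x, y) = [x : y : 1]`. -/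
def homCoord {W : WeierstrassCurve ℚ} : GeomPoint W → Fin 3 → QBar
  | .zero => ![0, 1, 0]
  | .some x y _ => ![x, y, 1]

/-- `φ` is a morphism of projective curves defined over `ℚ`: near every point `P` it is given by
`Q ↦ [f₀(Q) : f₁(Q) : f₂(Q)]` for homogeneous polynomials `fᵢ` of a common degree with rational
coefficients that do not all vanish at `P`. (Where all `fᵢ` vanish, the last clause is void; where
they do not, it says that `[f₀(Q) : f₁(Q) : f₂(Q)] = φ(Q)`.) -/
def IsMorphism {W W' : WeierstrassCurve ℚ} (φ : GeomPoint W → GeomPoint W') : Prop :=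
  ∀ P : GeomPoint W, ∃ (d : ℕ) (f : Fin 3 → MvPolynomial (Fin 3) ℚ),
    (∀ i, (f i).IsHomogeneous d) ∧
    (∃ i, MvPolynomial.aeval (homCoord P) (f i) ≠ 0) ∧
    ∀ (Q : GeomPoint W) (i j : Fin 3),
      MvPolynomial.aeval (homCoord Q) (f i) * homCoord (φ Q) j =
        MvPolynomial.aeval (homCoord Q) (f j) * homCoord (φ Q) i

open scoped Classical in
/-- `E` is the quotient `C / ⟨P⟩` over `ℚ`: `C` and `E` are elliptic curves over `ℚ` and there is an
isogeny `φ : C → E` over `ℚ` (a morphism of curves over `ℚ` with `φ(O) = O`, as in Silverman's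
*The Arithmetic of Elliptic Curves*) whose kernel `φ⁻¹(O)` is the subgroup generated by the rational
point `P`. Every isogeny is separable in characteristic
`0`, so this determines `E` up to isomorphism over `ℚ`. -/
def IsQuotientBy (E C : WeierstrassCurve ℚ) (P : RatPoint C) : Prop :=
  C.IsElliptic ∧ E.IsElliptic ∧
    ∃ φ : GeomPoint C → GeomPoint E, IsMorphism φ ∧ φ 0 = 0 ∧
      ∀ Q : GeomPoint C, φ Q = 0 ↔
        Q ∈ AddSubgroup.zmultiples (Affine.Point.baseChange ℚ QBar P)

/-- `E = C / ⟨P⟩` for some elliptic curve `C` over `ℚ` with a rational point `P` of order `3`. -/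
def IsQuotientByRationalThreeTorsion (E : WeierstrassCurve ℚ) : Prop :=
  ∃ (C : WeierstrassCurve ℚ) (P : RatPoint C), addOrderOf P = 3 ∧ IsQuotientBy E C P

/-! ### Reduction at the primes -/

/-- A Weierstrass equation of `W` over `ℚ_[p]` that is minimal at `p`. -/
def minimalAt (W : WeierstrassCurve ℚ) (p : ℕ) [Fact p.Prime] : WeierstrassCurve ℚ_[p] :=
  (W.baseChange ℚ_[p]).minimal ℤ_[p]

/-- `W` has good reduction at `p`. -/
def HasGoodReductionAt (W : WeierstrassCurve ℚ) (p : ℕ) [Fact p.Prime] : Prop :=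
  (minimalAt W p).HasGoodReduction ℤ_[p]

/-- `W` has multiplicative reduction at `p`. -/
def HasMultiplicativeReductionAt (W : WeierstrassCurve ℚ) (p : ℕ) [Fact p.Prime] : Prop :=
  (minimalAt W p).HasMultiplicativeReduction ℤ_[p]

/-- `W` is semistable: at every prime the reduction is good or multiplicative. -/
def IsSemistable (W : WeierstrassCurve ℚ) : Prop :=
  ∀ (p : ℕ) [Fact p.Prime], HasGoodReductionAt W p ∨ HasMultiplicativeReductionAt W p

/-- The order at `p` of the (minimal) discriminant of `W`. -/
def ordDisc (W : WeierstrassCurve ℚ) (p : ℕ) [Fact p.Prime] : ℤ :=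
  (minimalAt W p).Δ.valuation

/-! ### The curves `E_{m,n}`

The integer `ε = ±1` records the choice of signs: `±` is `ε` and `∓` is `-ε`. -/

/-- The admissible values of `m`. -/
def admissible : Finset ℕ := {1, 2, 5, 7, 8, 10, 11, 13, 14, 16, 17, 19, 22, 23}

/-- The exponent `i` of the power of `2` that is divided out. -/
def twoExp (m : ℕ) : ℕ :=
  if Odd m then 1 else if m = 8 ∨ m = 16 then 4 else 2

/-- The integer `2 (m + 24 n) (62208 n² + (5184 m ∓ 432) n + (108 m² ∓ 18 m + 1))`. -/
def fullValue (ε : ℤ) (m n : ℕ) : ℤ :=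
  2 * ((m : ℤ) + 24 * n) *
    (62208 * (n : ℤ) ^ 2 + (5184 * m - 432 * ε) * n + (108 * (m : ℤ) ^ 2 - 18 * ε * m + 1))

/-- The integer `δ_m(n)`, defined by `fullValue ε m n = 2 ^ i * δ_m(n)`; the division is exact for
admissible `m`. -/
def delta (ε : ℤ) (m n : ℕ) : ℤ := fullValue ε m n / 2 ^ twoExp m

theorem two_pow_mul_delta (ε : ℤ) {m : ℕ} (hm : m ∈ admissible) (n : ℕ) :
    2 ^ twoExp m * delta ε m n = fullValue ε m n := by
  apply Int.mul_ediv_cancel'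
  have key : (2 : ℤ) ^ twoExp m ∣ 2 * ((m : ℤ) + 24 * n) := by
    simp only [admissible, Finset.mem_insert, Finset.mem_singleton] at hm
    rcases hm with h | h | h | h | h | h | h | h | h | h | h | h | h | h <;> subst h <;>
      norm_num [twoExp, Nat.odd_iff] <;> omega
  exact Dvd.dvd.mul_right key _

/-- `A = 18 (m + 24 n) ∓ 1`. -/
def coeffA (ε : ℤ) (m n : ℕ) : ℚ := 18 * ((m : ℚ) + 24 * n) - ε

/-- `B = ± 4 / 9`. -/
def coeffB (ε : ℤ) : ℚ := ε * (4 / 9)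

/-- `D = -3`. -/
def coeffD : ℚ := -3

/-- `r = 1 / 3 + A²`. -/
def coeffR (ε : ℤ) (m n : ℕ) : ℚ := 1 / 3 + coeffA ε m n ^ 2

/-- `H(m, n) = (2 A B D + 2 A² D r + 3 r²) / 16`. -/
def coeffH (ε : ℤ) (m n : ℕ) : ℚ :=
  (2 * coeffA ε m n * coeffB ε * coeffD + 2 * coeffA ε m n ^ 2 * coeffD * coeffR ε m n +
    3 * coeffR ε m n ^ 2) / 16

/-- `J(m, n) = (B² D + 2 A B D r + A² D r² + r³) / 64`. -/
def coeffJ (ε : ℤ) (m n : ℕ) : ℚ :=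
  (coeffB ε ^ 2 * coeffD + 2 * coeffA ε m n * coeffB ε * coeffD * coeffR ε m n +
    coeffA ε m n ^ 2 * coeffD * coeffR ε m n ^ 2 + coeffR ε m n ^ 3) / 64

/-- The curve `E_{m,n} : y² + x y = x³ + H(m, n) x + J(m, n)` over `ℚ`. -/
def curveE (ε : ℤ) (m n : ℕ) : WeierstrassCurve ℚ where
  a₁ := 1
  a₂ := 0
  a₃ := 0
  a₄ := coeffH ε m n
  a₆ := coeffJ ε m n

end ThreeIsogeny

end

noncomputable section

/-! ### Squarefree values of a product of a linear and a quadratic polynomial -/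

namespace ThreeIsogeny

open Finset Filter

/-! Put t = m + 24n and F = `fullValue ε m n` = 2t(108t² - 18εt + 1). Everything rests on the
identity A³ + ε = 27F. Reduction: the given equation is integral, with Δ = -εF and c₄ = A(9A³ + 8ε).
A prime dividing F divides neither A nor 9A³ + 8ε = 9(A³ + ε) - ε, so Δ and c₄ are coprime. Hence
the equation is minimal everywhere, the reduction is good or multiplicative, and the order of the
discriminant at p is that of F (`minimalAt_curveE`). Since 3 ∤ F, reduction at 3 is good;
squarefreeness of δ makes the order of F equal to 1 at its odd primes, and 1, 2, 4 or 5 at 2.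
Isogeny: y² = x³ + (ax + b)² has the flex (0, b), and its quotient by this point is Y² = X³ - 3(aX +
B)² with B = 3b - 4a³/9. Taking a = A and b = 4(A³ + ε)/27 gives B = 4ε/9, which is E. Squarefree
values: δ is a product of coprime linear and quadratic factors, both O(N²) for n < N, so only primes
p ≤ KN can have p² dividing one of them. Each p ≥ 5 excludes at most three classes modulo p², and
the prime 2 at most one class modulo 4. The excluded density is at most 2/3 + 1/4 < 1, and the
rounding errors are O(π(KN)) = o(N) (`infinite_squarefree_linear_mul_quadratic`). -/

theorem card_filter_dvd_linear_le (d : ℕ) (a b : ℤ) (hd : 0 < d) (h : IsCoprime (d : ℤ) a) (N : ℕ) :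
    #{n ∈ range N | (d : ℤ) ∣ a * (n : ℕ) + b} ≤ N / d + 1 := by
  rcases Finset.eq_empty_or_nonempty {n ∈ range N | (d : ℤ) ∣ a * (n : ℕ) + b} with h0 | ⟨k, hk⟩
  · simp [h0]
  · have hk' := (mem_filter.1 hk).2
    calc _ ≤ #{n ∈ range N | n ≡ k [MOD d]} := by
          refine card_le_card fun n hn => ?_
          rw [mem_filter] at hn ⊢
          refine ⟨hn.1, ?_⟩
          have h1 : (d : ℤ) ∣ a * ((k : ℤ) - n) := by
            obtain ⟨u, hu⟩ := hk'
            obtain ⟨v, hv⟩ := hn.2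
            exact ⟨u - v, by linear_combination hu - hv⟩
          exact (Nat.modEq_iff_dvd).2 (h.dvd_of_dvd_mul_left h1)
      _ = N.count (· ≡ k [MOD d]) := (Nat.count_eq_card_filter_range _ _).symm
      _ ≤ N / d + 1 := by
          rw [Nat.count_modEq_card _ hd]
          split_ifs <;> omega

/-- If `p ≥ 5` and `4 q = 3 z² + 1`, then `p² ∣ q(n)` confines `n` to two classes modulo `p²`. -/
theorem card_filter_sq_dvd_quadratic_le (p : ℕ) (hp : p.Prime) (h5 : 5 ≤ p) (c : ℤ) (q : ℕ → ℤ)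
    (hq : ∀ n, 4 * q n = 3 * (288 * (n : ℤ) + c) ^ 2 + 1) (N : ℕ) :
    #{n ∈ range N | ((p ^ 2 : ℕ) : ℤ) ∣ q n} ≤ 2 * (N / p ^ 2 + 1) := by
  rcases Finset.eq_empty_or_nonempty {n ∈ range N | ((p ^ 2 : ℕ) : ℤ) ∣ q n} with h0 | ⟨k, hk⟩
  · rw [h0]; simp
  have hk' := (mem_filter.1 hk).2
  have hpi : Prime (p : ℤ) := Nat.prime_iff_prime_int.1 hp
  have hcop : ∀ x : ℕ, x.Prime → x ≠ p → IsCoprime (p : ℤ) x := fun x hx hne =>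
    Nat.isCoprime_iff_coprime.2 ((Nat.coprime_primes hp hx).2 hne.symm)
  have h2 : IsCoprime (p : ℤ) 2 := hcop 2 Nat.prime_two (by omega)
  have h3 : IsCoprime (p : ℤ) 3 := hcop 3 Nat.prime_three (by omega)
  have h288 : IsCoprime ((p ^ 2 : ℕ) : ℤ) 288 := by
    have : (288 : ℤ) = 2 ^ 5 * 3 ^ 2 := by norm_num
    rw [this, Nat.cast_pow]
    exact IsCoprime.mul_right (h2.pow (m := 2) (n := 5)) (h3.pow (m := 2) (n := 2))
  have hd : 0 < p ^ 2 := by positivity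
  -- With z = 288n + c and z₀ its value at the fixed solution k, 4(q(n) - q(k)) = 3(z - z₀)(z + z₀).
  -- If p divided both factors it would divide z, hence 4q - 3z² = 1; so p² divides one of them.
  have key : ∀ n : ℕ, ((p ^ 2 : ℕ) : ℤ) ∣ q n →
      ((p ^ 2 : ℕ) : ℤ) ∣ 288 * (n : ℤ) + (- (288 * (k : ℤ))) ∨
      ((p ^ 2 : ℕ) : ℤ) ∣ 288 * (n : ℤ) + (288 * (k : ℤ) + 2 * c) := by
    intro n hn
    have hdiv : ((p ^ 2 : ℕ) : ℤ) ∣ 3 * ((288 * (n : ℤ) + (- (288 * (k : ℤ)))) *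
        (288 * (n : ℤ) + (288 * (k : ℤ) + 2 * c))) := by
      obtain ⟨u, hu⟩ := hn
      obtain ⟨v, hv⟩ := hk'
      exact ⟨4 * (u - v), by linear_combination hq k - hq n + 4 * hu - 4 * hv⟩
    push_cast at hdiv ⊢
    replace hdiv := (h3.pow_left (m := 2)).dvd_of_dvd_mul_left hdiv
    by_cases hx : (p : ℤ) ∣ 288 * (n : ℤ) + (- (288 * (k : ℤ)))
    · by_cases hy : (p : ℤ) ∣ 288 * (n : ℤ) + (288 * (k : ℤ) + 2 * c)
      · exfalso
        have hz : (p : ℤ) ∣ 2 * (288 * (n : ℤ) + c) := by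
          obtain ⟨u, hu⟩ := hx
          obtain ⟨v, hv⟩ := hy
          exact ⟨u + v, by linear_combination hu + hv⟩
        replace hz := h2.dvd_of_dvd_mul_left hz
        have hpq : (p : ℤ) ∣ q n := (Dvd.intro_left _ (by push_cast; ring)).trans hn
        have h1 : (p : ℤ) ∣ 1 := by
          have := dvd_sub (hpq.mul_left 4) ((hz.pow (n := 2) (by norm_num)).mul_left 3)
          rw [hq] at this
          simpa using this
        exact hpi.not_isUnit (isUnit_of_dvd_one h1)
      · exact Or.inl ((((Prime.coprime_iff_not_dvd hpi).2 hy).pow_left).dvd_of_dvd_mul_right hdiv)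
    · exact Or.inr ((((Prime.coprime_iff_not_dvd hpi).2 hx).pow_left).dvd_of_dvd_mul_left hdiv)
  calc _ ≤ #({n ∈ range N | ((p ^ 2 : ℕ) : ℤ) ∣ 288 * (n : ℕ) + (- (288 * (k : ℤ)))} ∪
        {n ∈ range N | ((p ^ 2 : ℕ) : ℤ) ∣ 288 * (n : ℕ) + (288 * (k : ℤ) + 2 * c)}) := by
        refine card_le_card fun n hn => ?_
        rw [mem_filter] at hn
        rw [mem_union, mem_filter, mem_filter]
        exact (key n hn.2).imp (⟨hn.1, ·⟩) (⟨hn.1, ·⟩)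
    _ ≤ (N / p ^ 2 + 1) + (N / p ^ 2 + 1) := (card_union_le _ _).trans
        (add_le_add (card_filter_dvd_linear_le _ _ _ hd h288 N)
          (card_filter_dvd_linear_le _ _ _ hd h288 N))
    _ = _ := by ring

/-- Telescoping of 1/k² ≤ 1/(k - 1/2) - 1/(k + 1/2), starting from 1/(9/2) = 2/9. -/
theorem sum_inv_sq_Ico_five_le (M : ℕ) :
    ∑ k ∈ Ico 5 (5 + M), (1 : ℝ) / (k : ℝ) ^ 2 ≤ 2 / 9 - 1 / (M + 9 / 2) := by
  induction M with
  | zero => norm_num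
  | succ M ih =>
    rw [← add_assoc, Finset.sum_Ico_succ_top (by omega)]
    have h : (1 : ℝ) / ((5 + M : ℕ) : ℝ) ^ 2 ≤ 1 / ((M : ℝ) + 9 / 2) - 1 / (M + 1 + 9 / 2) := by
      have h0 : (0 : ℝ) ≤ M := M.cast_nonneg
      rw [div_sub_div _ _ (by positivity) (by positivity), div_le_div_iff₀ (by positivity)
        (by positivity)]
      push_cast
      nlinarith
    push_cast at h ⊢
    linarith

theorem sum_primes_inv_sq_le (M : ℕ) :
    ∑ p ∈ Icc 5 M with p.Prime, (1 : ℝ) / (p : ℝ) ^ 2 ≤ 2 / 9 := by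
  have h1 : ∑ p ∈ Icc 5 M with p.Prime, (1 : ℝ) / (p : ℝ) ^ 2 ≤
      ∑ k ∈ Ico 5 (5 + M), (1 : ℝ) / (k : ℝ) ^ 2 := by
    refine sum_le_sum_of_subset_of_nonneg (fun p hp => ?_) (fun _ _ _ => by positivity)
    simp only [mem_filter, mem_Icc, mem_Ico] at hp ⊢
    omega
  have h2 : (0 : ℝ) ≤ 1 / (M + 9 / 2) := by positivity
  linarith [sum_inv_sq_Ico_five_le M]

/-- Chebyshev's bound π(x) = O(x / log x). It absorbs the rounding error of the sieve, one bounded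
term for each prime up to KN. -/
theorem eventually_primeCounting_mul_le (K : ℕ) (hK : 0 < K) {η : ℝ} (hη : 0 < η) :
    ∀ᶠ N : ℕ in atTop, (Nat.primeCounting (K * N) : ℝ) ≤ η * N := by
  have hlog := (Real.tendsto_log_atTop.eventually_ge_atTop
    ((Real.log 4 + 1) * K / η)).and ((Chebyshev.eventually_primeCounting_le one_pos).and
      (eventually_gt_atTop (1 : ℝ)))
  have htend : Tendsto (fun N : ℕ => ((K * N : ℕ) : ℝ)) atTop atTop :=
    tendsto_natCast_atTop_atTop.comp (Filter.tendsto_id.const_mul_atTop' hK)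
  filter_upwards [htend.eventually hlog] with N ⟨h1, h2, h3⟩
  rw [Nat.floor_natCast] at h2
  have hl : 0 < Real.log ((K * N : ℕ) : ℝ) := Real.log_pos h3
  refine h2.trans ?_
  rw [div_le_iff₀ hl]
  rw [div_le_iff₀ hη] at h1
  push_cast at h1 ⊢
  have hN : (0 : ℝ) ≤ N := N.cast_nonneg
  nlinarith [mul_le_mul_of_nonneg_right h1 hN]

/-- A product of coprime integers, the first one linear in `n` and the second one quadratic in `n`
of the form `(3 z² + 1) / 4`, is squarefree for infinitely many `n`. -/
theorem infinite_squarefree_linear_mul_quadratic (a b c : ℤ) (l q f : ℕ → ℤ) (K : ℕ)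
    (hl : ∀ n, l n = a * (n : ℤ) + b)
    (hq : ∀ n, 4 * q n = 3 * (288 * (n : ℤ) + c) ^ 2 + 1)
    (hf : ∀ n, f n = l n * q n) (hcop : ∀ n, IsCoprime (l n) (q n))
    (ha : ∀ p : ℕ, p.Prime → 5 ≤ p → IsCoprime (p : ℤ) a)
    (hl3 : ∀ n, ¬ (3 : ℤ) ∣ l n) (hl2 : Odd a ∨ ∀ n, ¬ (2 : ℤ) ∣ l n)
    (hq2 : ∀ n, ¬ (2 : ℤ) ∣ q n) (hq3 : ∀ n, ¬ (3 : ℤ) ∣ q n)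
    (hlpos : ∀ n, 0 < l n) (hqpos : ∀ n, 0 < q n)
    (hlK : ∀ n N : ℕ, n < N → l n ≤ (K * N) ^ 2) (hqK : ∀ n N : ℕ, n < N → q n ≤ (K * N) ^ 2) :
    {n : ℕ | 0 < n ∧ Squarefree (f n)}.Infinite := by
  intro hfin
  obtain ⟨B, hB⟩ := hfin.bddAbove
  have hbad : ∀ n, B < n → (4 : ℤ) ∣ l n ∧ Odd a ∨ ∃ p : ℕ, p.Prime ∧ 5 ≤ p ∧
      (((p ^ 2 : ℕ) : ℤ) ∣ l n ∨ ((p ^ 2 : ℕ) : ℤ) ∣ q n) := by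
    intro n hn
    have hns : ¬ Squarefree (f n) := fun h => absurd (hB ⟨by omega, h⟩) (by omega)
    rw [hf, squarefree_mul_iff] at hns
    have hex : ∃ p : ℕ, p.Prime ∧ (((p ^ 2 : ℕ) : ℤ) ∣ l n ∨ ((p ^ 2 : ℕ) : ℤ) ∣ q n) := by
      have aux : ∀ x : ℤ, ¬ Squarefree x → ∃ p : ℕ, p.Prime ∧ ((p ^ 2 : ℕ) : ℤ) ∣ x := by
        intro x hx
        rw [← Int.squarefree_natAbs, Nat.squarefree_iff_prime_squarefree] at hx
        push Not at hx
        obtain ⟨p, hp, h⟩ := hx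
        exact ⟨p, hp, by rw [sq]; exact Int.natCast_dvd.2 h⟩
      by_cases h1 : Squarefree (l n)
      · by_cases h2 : Squarefree (q n)
        · exact absurd ⟨(hcop n).isRelPrime, h1, h2⟩ hns
        · obtain ⟨p, hp, h⟩ := aux _ h2; exact ⟨p, hp, Or.inr h⟩
      · obtain ⟨p, hp, h⟩ := aux _ h1; exact ⟨p, hp, Or.inl h⟩
    obtain ⟨p, hp, h⟩ := hex
    have hpd : ∀ x : ℤ, ((p ^ 2 : ℕ) : ℤ) ∣ x → (p : ℤ) ∣ x := fun x hx =>
      (Dvd.intro_left _ (by push_cast; ring)).trans hx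
    by_cases h5 : 5 ≤ p
    · exact Or.inr ⟨p, hp, h5, h⟩
    · left
      have : p = 2 ∨ p = 3 := by
        have := hp.two_le
        interval_cases p <;> first | omega | exact absurd hp (by decide)
      rcases this with rfl | rfl
      · have h4 := h.resolve_right fun h' => hq2 n (hpd _ h')
        exact ⟨by simpa using h4, hl2.resolve_right fun h' => h' n (hpd _ h4)⟩
      · exact (h.elim (fun h' => hl3 n (hpd _ h')) fun h' => hq3 n (hpd _ h')).elim
  -- Every n < N is either at most B or excluded by a prime square. The term N/4 + 1 is the prime 2;
  -- the last one is the sum over 5 ≤ p ≤ KN of 3(N/p² + 1), with ∑ 1/p² ≤ 2/9.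
  have hcount : ∀ N : ℕ, (N : ℝ) ≤ (B + 1) + (N / 4 + 1) +
      (N * (2 / 3) + 3 * (Nat.primeCounting (K * N) : ℝ)) := by
    intro N
    set S : Finset ℕ := {p ∈ Icc 5 (K * N) | p.Prime} with hS
    have hsub : range N ⊆ (range (B + 1) ∪ {n ∈ range N | (4 : ℤ) ∣ l n ∧ Odd a}) ∪
        S.biUnion fun p => {n ∈ range N | ((p ^ 2 : ℕ) : ℤ) ∣ l n} ∪
          {n ∈ range N | ((p ^ 2 : ℕ) : ℤ) ∣ q n} := by
      intro n hn
      have hnN := mem_range.1 hn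
      rcases le_or_gt n B with h | h
      · exact mem_union_left _ (mem_union_left _ (mem_range.2 (by omega)))
      rcases hbad n h with h | ⟨p, hp, h5, h⟩
      · exact mem_union_left _ (mem_union_right _ (mem_filter.2 ⟨hn, h⟩))
      · refine mem_union_right _ (mem_biUnion.2 ⟨p, ?_, ?_⟩)
        · rw [hS, mem_filter, mem_Icc]
          refine ⟨⟨h5, ?_⟩, hp⟩
          have hle : ((p ^ 2 : ℕ) : ℤ) ≤ (K * N) ^ 2 := by
            rcases h with h | h
            · exact (Int.le_of_dvd (hlpos n) h).trans (hlK n N hnN)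
            · exact (Int.le_of_dvd (hqpos n) h).trans (hqK n N hnN)
          have hle' : p ^ 2 ≤ (K * N) ^ 2 := by exact_mod_cast hle
          exact (Nat.pow_le_pow_iff_left two_ne_zero).1 hle'
        · rw [mem_union, mem_filter, mem_filter]
          exact h.imp (⟨hn, ·⟩) (⟨hn, ·⟩)
    have hfour : #{n ∈ range N | (4 : ℤ) ∣ l n ∧ Odd a} ≤ N / 4 + 1 := by
      by_cases hodd : Odd a
      · have h24 : IsCoprime ((4 : ℕ) : ℤ) a := by
          have h := (Int.isCoprime_two_left.2 hodd).pow_left (m := 2)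
          norm_num at h ⊢; exact h
        refine le_trans (card_le_card fun n hn => ?_)
          (card_filter_dvd_linear_le 4 a b (by norm_num) h24 N)
        rw [mem_filter] at hn ⊢
        exact ⟨hn.1, by simpa [← hl] using hn.2.1⟩
      · simp [hodd]
    have hp : ∀ p ∈ S, #({n ∈ range N | ((p ^ 2 : ℕ) : ℤ) ∣ l n} ∪
        {n ∈ range N | ((p ^ 2 : ℕ) : ℤ) ∣ q n}) ≤ 3 * (N / p ^ 2 + 1) := by
      intro p hpS
      rw [hS, mem_filter, mem_Icc] at hpS
      have h1 := card_filter_sq_dvd_quadratic_le p hpS.2 hpS.1.1 c q hq N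
      have h2 := card_filter_dvd_linear_le (p ^ 2) a b (pow_pos hpS.2.pos 2)
        (by push_cast; exact (ha p hpS.2 hpS.1.1).pow_left) N
      simp_rw [← hl] at h2
      exact (card_union_le _ _).trans (by omega)
    have hScard : (#S : ℝ) ≤ Nat.primeCounting (K * N) := by
      rw [Nat.primeCounting, Nat.primeCounting', Nat.count_eq_card_filter_range]
      exact_mod_cast card_le_card fun p hp => by
        simp only [hS, mem_filter, mem_Icc, mem_range] at hp ⊢
        exact ⟨by omega, hp.2⟩
    have hnat := (card_le_card hsub).trans ((card_union_le _ _).trans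
      (add_le_add ((card_union_le _ _).trans (add_le_add le_rfl hfour))
        (card_biUnion_le.trans (sum_le_sum hp))))
    rw [card_range, card_range] at hnat
    have hreal : (N : ℝ) ≤ ((B + 1 : ℕ) : ℝ) + ((N / 4 : ℕ) + 1) +
        ∑ p ∈ S, 3 * (((N / p ^ 2 : ℕ) : ℝ) + 1) := by exact_mod_cast hnat
    have hsum : ∑ p ∈ S, 3 * (((N / p ^ 2 : ℕ) : ℝ) + 1) ≤
        N * (2 / 3) + 3 * (Nat.primeCounting (K * N) : ℝ) := by
      calc _ ≤ ∑ p ∈ S, (3 * (N : ℝ) * (1 / (p : ℝ) ^ 2) + 3) := by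
            refine sum_le_sum fun p _ => ?_
            have : ((N / p ^ 2 : ℕ) : ℝ) ≤ (N : ℝ) / ((p ^ 2 : ℕ) : ℝ) := Nat.cast_div_le
            push_cast at this
            calc _ ≤ 3 * ((N : ℝ) / (p : ℝ) ^ 2 + 1) := by gcongr
              _ = _ := by ring
        _ = 3 * (N : ℝ) * ∑ p ∈ S, 1 / (p : ℝ) ^ 2 + 3 * (#S : ℝ) := by
            rw [sum_add_distrib, ← mul_sum, sum_const, nsmul_eq_mul]; ring
        _ ≤ 3 * (N : ℝ) * (2 / 9) + 3 * (Nat.primeCounting (K * N) : ℝ) := by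
            have := sum_primes_inv_sq_le (K * N)
            gcongr
        _ = _ := by ring
    have h4 : ((N / 4 : ℕ) : ℝ) ≤ N / 4 := by exact_mod_cast Nat.cast_div_le (m := N) (n := 4)
    push_cast at hreal
    linarith
  have hK : 0 < K := by
    rcases Nat.eq_zero_or_pos K with rfl | h
    · have := hlK 0 1 one_pos
      have := hlpos 0
      simp at *; omega
    · exact h
  -- 1/4 + 2/3 + 3/72 = 23/24, so the count would force N/24 ≤ B + 2.
  obtain ⟨N, hN1, hN2⟩ := ((eventually_primeCounting_mul_le K hK (η := 1 / 72) (by norm_num)).and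
    (eventually_gt_atTop (24 * (B + 2)))).exists
  have h := hcount N
  have hN3 : (24 * (B + 2) : ℝ) < N := by exact_mod_cast hN2
  linarith

end ThreeIsogeny

/-! ### Minimal equations with unit discriminant or unit `c₄` -/

section Minimal

open IsDiscreteValuationRing IsDedekindDomain.HeightOneSpectrum

variable (R : Type*) [CommRing R] [IsDomain R] [IsDiscreteValuationRing R]
  {K : Type*} [Field K] [Algebra R K] [IsFractionRing R K]

/-- An integral Weierstrass equation whose discriminant or `c₄` is a unit differs from a minimal one
by a change of variables with unit scaling factor. -/
theorem WeierstrassCurve.exists_minimal_eq_of_isIntegral (W : WeierstrassCurve K) [IsIntegral R W]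
    (h0 : W.Δ ≠ 0)
    (h : valuation K (maximalIdeal R) W.Δ = 1 ∨ valuation K (maximalIdeal R) W.c₄ = 1) :
    ∃ u : K, valuation K (maximalIdeal R) u = 1 ∧
      (W.minimal R).Δ = u ^ 12 * W.Δ ∧ (W.minimal R).c₄ = u ^ 4 * W.c₄ := by
  set v := valuation K (maximalIdeal R)
  obtain ⟨C, hC⟩ : ∃ C : VariableChange K, W.minimal R = C • W := ⟨_, rfl⟩
  have hΔ : (W.minimal R).Δ = (C.u⁻¹ : Kˣ) ^ 12 * W.Δ := by rw [hC, variableChange_Δ]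
  have hc : (W.minimal R).c₄ = (C.u⁻¹ : Kˣ) ^ 4 * W.c₄ := by rw [hC, variableChange_c₄]
  refine ⟨(C.u⁻¹ : Kˣ), ?_, hΔ, hc⟩
  have hmin : IsMinimal R (W.minimal R) := inferInstance
  have hint : ∀ x : R, v (algebraMap R K x) ≤ 1 := valuation_le_one (maximalIdeal R)
  have hback : C⁻¹ • W.minimal R = W := by rw [hC, inv_smul_smul]
  -- Maximality of v(Δ) for the minimal equation is tested against the change of variables leading
  -- back to W. It bounds v(u) from below; integrality of the minimal Δ or c₄ bounds it from above.
  have hmax := hmin.val_Δ_maximal.2 (j := C⁻¹) (by simpa only [hback])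
  simp only [one_smul, hback] at hmax
  have hle : v W.Δ ≤ v (W.minimal R).Δ := by
    rcases le_total (valuation_Δ_aux R (W.minimal R)) (valuation_Δ_aux R W) with h' | h'
    · have := hmax h'
      rwa [← Subtype.coe_le_coe, valuation_Δ_aux_eq_of_isIntegral,
        valuation_Δ_aux_eq_of_isIntegral] at this
    · rwa [← Subtype.coe_le_coe, valuation_Δ_aux_eq_of_isIntegral,
        valuation_Δ_aux_eq_of_isIntegral] at h'
  have hpos : 0 < v W.Δ := zero_lt_iff.2 ((Valuation.ne_zero_iff _).2 h0)
  apply le_antisymm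
  · rcases h with h | h
    · have h1 := hint (integralModel R (W.minimal R)).Δ
      rw [integralModel_Δ_eq, hΔ, map_mul, map_pow, h, mul_one] at h1
      exact (pow_le_one_iff_of_nonneg zero_le (by norm_num)).1 h1
    · have h1 := hint (integralModel R (W.minimal R)).c₄
      rw [integralModel_c₄_eq, hc, map_mul, map_pow, h, mul_one] at h1
      exact (pow_le_one_iff_of_nonneg zero_le (by norm_num)).1 h1
  · rw [hΔ, map_mul, map_pow] at hle
    by_contra! hlt
    have h12 := pow_lt_one₀ zero_le hlt (n := 12) (by norm_num)
    exact absurd hle (not_le.2 (by simpa using mul_lt_mul_of_pos_right h12 hpos))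

end Minimal

namespace ThreeIsogeny

open IsDiscreteValuationRing IsDedekindDomain.HeightOneSpectrum

/-! ### The valuation of ℤ_p on integers, and its agreement with the additive p-adic valuation on
units -/

section Padic

variable (p : ℕ) [Fact p.Prime]

theorem valuation_intCast_eq_one_iff (d : ℤ) :
    valuation ℚ_[p] (maximalIdeal ℤ_[p]) (d : ℚ_[p]) = 1 ↔ ¬ (p : ℤ) ∣ d := by
  have : (d : ℚ_[p]) = algebraMap ℤ_[p] ℚ_[p] d := by simp
  rw [this, valuation_eq_one_iff_notMem, ← PadicInt.norm_int_lt_one_iff_dvd,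
    ← PadicInt.mem_nonunits]
  rfl

theorem padicValuation_eq_zero_of_valuation_eq_one {x : ℚ_[p]}
    (hx : valuation ℚ_[p] (maximalIdeal ℤ_[p]) x = 1) : x.valuation = 0 := by
  obtain ⟨y, rfl⟩ := exists_lift_of_le_one hx.le
  rw [valuation_eq_one_iff_notMem] at hx
  have hy : IsUnit y := by
    by_contra h
    exact hx h
  have hn : ‖(y : ℚ_[p])‖ = 1 := by
    rw [← PadicInt.norm_def]; exact PadicInt.isUnit_iff.1 hy
  have hy0 : (y : ℚ_[p]) ≠ 0 := fun h => by simp [h] at hn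
  rw [Padic.norm_eq_zpow_neg_valuation hy0] at hn
  have hp1 : (1 : ℝ) < p := by exact_mod_cast (Fact.out : p.Prime).one_lt
  have := (zpow_eq_one_iff_right₀ (zero_le_one.trans hp1.le) hp1.ne').1 hn
  simpa using this

end Padic

/-! ### Invariants of `E_{m,n}` -/

/-- Both coefficients are polynomials in s = ε(m + 24n) with denominators dividing 4; substituting
s² = s + 2k removes the denominators. -/
theorem exists_intCast_eq_coeffH_coeffJ (ε : ℤ) (hε : ε = 1 ∨ ε = -1) (m n : ℕ) :
    (∃ h : ℤ, (h : ℚ) = coeffH ε m n) ∧ ∃ j : ℤ, (j : ℚ) = coeffJ ε m n := by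
  obtain ⟨k, hk⟩ := Int.even_mul_pred_self (ε * (m + 24 * n))
  set s : ℤ := ε * (m + 24 * n) with hs
  have hk' : (s : ℚ) * (s - 1) = k + k := by exact_mod_cast hk
  have hsq : (s : ℚ) = ε * (m + 24 * n) := by rw [hs]; push_cast; ring
  constructor
  · refine ⟨-729 * k - 354 * s + 4374 * s ^ 3 - 19683 * s ^ 4, ?_⟩
    have : coeffH ε m n = 21 / 2 * s - 729 / 2 * (s : ℚ) ^ 2 + 4374 * s ^ 3 - 19683 * s ^ 4 := by
      rw [hsq]
      rcases hε with rfl | rfl <;>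
      · simp only [coeffH, coeffR, coeffA, coeffB, coeffD]
        push_cast
        ring
    rw [this]
    push_cast
    linear_combination 729 / 2 * hk'
  · refine ⟨-94446 * k - 47223 * s - 195858 * k * s - 203391 * k ^ 2 + 2 * s + 354294 * s ^ 5 -
      1062882 * s ^ 6, ?_⟩
    have : coeffJ ε m n = 2 * s - 567 / 4 * (s : ℚ) ^ 2 + 7533 / 2 * s ^ 3 - 203391 / 4 * s ^ 4 +
        354294 * s ^ 5 - 1062882 * s ^ 6 := by
      rw [hsq]
      rcases hε with rfl | rfl <;>
      · simp only [coeffJ, coeffR, coeffA, coeffB, coeffD]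
        push_cast
        ring
    rw [this]
    push_cast
    linear_combination (567 / 4 - 7533 / 2 * (s + 1 : ℚ) +
      203391 / 4 * ((s : ℚ) ^ 2 + s + 2 * k + 1)) * hk'

theorem curveE_Δ (ε : ℤ) (hε : ε = 1 ∨ ε = -1) (m n : ℕ) :
    (curveE ε m n).Δ = ((-ε * fullValue ε m n : ℤ) : ℚ) := by
  rcases hε with rfl | rfl <;>
  · simp only [WeierstrassCurve.Δ, b₂, b₄, b₆, b₈, curveE, coeffH, coeffJ, coeffR, coeffA, coeffB,
      coeffD, fullValue]
    push_cast
    ring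

theorem curveE_c₄ (ε : ℤ) (hε : ε = 1 ∨ ε = -1) (m n : ℕ) :
    (curveE ε m n).c₄ = (((18 * (m + 24 * n) - ε) * (9 * (18 * (m + 24 * n) - ε) ^ 3 + 8 * ε) : ℤ) :
      ℚ) := by
  rcases hε with rfl | rfl <;>
  · simp only [WeierstrassCurve.c₄, b₂, b₄, curveE, coeffH, coeffR, coeffA, coeffB, coeffD]
    push_cast
    ring

theorem not_dvd_c₄_of_dvd_Δ (ε : ℤ) (hε : ε = 1 ∨ ε = -1) (m n p : ℕ) (hp : p.Prime)
    (h : (p : ℤ) ∣ fullValue ε m n) :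
    ¬ (p : ℤ) ∣ (18 * (m + 24 * n) - ε) * (9 * (18 * (m + 24 * n) - ε) ^ 3 + 8 * ε) := by
  intro h'
  have hpi : Prime (p : ℤ) := Nat.prime_iff_prime_int.1 hp
  have key : (18 * ((m : ℤ) + 24 * n) - ε) ^ 3 + ε = 27 * fullValue ε m n := by
    rcases hε with rfl | rfl <;> simp only [fullValue] <;> ring
  obtain ⟨u, hu⟩ := h
  have hpe : ¬ (p : ℤ) ∣ ε := fun hd => hpi.not_isUnit <| isUnit_of_dvd_unit hd <| by
    rcases hε with rfl | rfl <;> simp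
  rcases hpi.dvd_or_dvd h' with ⟨w, hw⟩ | ⟨w, hw⟩
  · refine hpe ⟨27 * u - w * (p * w) ^ 2, ?_⟩
    rw [hw, hu] at key
    linear_combination key
  · exact hpe ⟨9 * 27 * u - w, by linear_combination 9 * 27 * hu - hw + 9 * key⟩

/-! ### Reduction of `E_{m,n}` -/

section Reduction

variable (ε : ℤ) (hε : ε = 1 ∨ ε = -1) (m n p : ℕ) [Fact p.Prime]

include hε in
theorem isIntegral_curveE : IsIntegral ℤ_[p] ((curveE ε m n).baseChange ℚ_[p]) := by
  obtain ⟨⟨h, hh⟩, j, hj⟩ := exists_intCast_eq_coeffH_coeffJ ε hε m n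
  refine isIntegral_of_exists_lift ℤ_[p] ⟨1, ?_⟩ ⟨0, ?_⟩ ⟨0, ?_⟩ ⟨h, ?_⟩ ⟨j, ?_⟩ <;>
    simp [WeierstrassCurve.baseChange, curveE, ← hh, ← hj]

include hε in
theorem minimalAt_curveE (h0 : fullValue ε m n ≠ 0) :
    (valuation ℚ_[p] (maximalIdeal ℤ_[p]) (minimalAt (curveE ε m n) p).Δ = 1 ↔
      ¬ (p : ℤ) ∣ fullValue ε m n) ∧
    ((p : ℤ) ∣ fullValue ε m n →
      valuation ℚ_[p] (maximalIdeal ℤ_[p]) (minimalAt (curveE ε m n) p).c₄ = 1) ∧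
    ordDisc (curveE ε m n) p = padicValInt p (fullValue ε m n) := by
  have hΔ : ((curveE ε m n).baseChange ℚ_[p]).Δ = ((-ε * fullValue ε m n : ℤ) : ℚ_[p]) := by
    rw [WeierstrassCurve.baseChange, map_Δ, curveE_Δ ε hε]
    exact map_intCast _ _
  have hc : ((curveE ε m n).baseChange ℚ_[p]).c₄ =
      (((18 * (m + 24 * n) - ε) * (9 * (18 * (m + 24 * n) - ε) ^ 3 + 8 * ε) : ℤ) : ℚ_[p]) := by
    rw [WeierstrassCurve.baseChange, map_c₄, curveE_c₄ ε hε]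
    exact map_intCast _ _
  have hεu : IsUnit (-ε) := by rcases hε with rfl | rfl <;> simp
  have hne : -ε * fullValue ε m n ≠ 0 := mul_ne_zero hεu.ne_zero h0
  have hcu := not_dvd_c₄_of_dvd_Δ ε hε m n p Fact.out
  have := isIntegral_curveE ε hε m n p
  obtain ⟨u, hu, huΔ, huc⟩ := exists_minimal_eq_of_isIntegral ℤ_[p]
    ((curveE ε m n).baseChange ℚ_[p]) (by rw [hΔ]; exact_mod_cast hne) (by
      rw [hΔ, hc, valuation_intCast_eq_one_iff, valuation_intCast_eq_one_iff, hεu.dvd_mul_left]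
      tauto)
  refine ⟨?_, fun h => ?_, ?_⟩
  · rw [minimalAt, huΔ, map_mul, map_pow, hu, one_pow, one_mul, hΔ, valuation_intCast_eq_one_iff,
      hεu.dvd_mul_left]
  · rw [minimalAt, huc, map_mul, map_pow, hu, one_pow, one_mul, hc, valuation_intCast_eq_one_iff]
    exact hcu h
  · have hu0 : u ≠ 0 := by rintro rfl; simp at hu
    rw [ordDisc, minimalAt, huΔ, hΔ, Padic.valuation_mul (pow_ne_zero _ hu0)
      (by exact_mod_cast hne), Padic.valuation_pow, padicValuation_eq_zero_of_valuation_eq_one p hu,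
      Padic.valuation_intCast, padicValInt, padicValInt, Int.natAbs_mul,
      Int.isUnit_iff_natAbs_eq.1 hεu]
    simp

include hε in
theorem hasGoodReductionAt_curveE_iff (h0 : fullValue ε m n ≠ 0) :
    HasGoodReductionAt (curveE ε m n) p ↔ ¬ (p : ℤ) ∣ fullValue ε m n := by
  rw [← (minimalAt_curveE ε hε m n p h0).1, HasGoodReductionAt, hasGoodReduction_iff]
  exact and_iff_right (by rw [minimalAt]; infer_instance)

include hε in
theorem isSemistable_curveE (h0 : fullValue ε m n ≠ 0) : IsSemistable (curveE ε m n) := by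
  intro p _
  rw [or_iff_not_imp_left, hasGoodReductionAt_curveE_iff ε hε m n p h0, not_not]
  intro h
  obtain ⟨h1, h2, -⟩ := minimalAt_curveE ε hε m n p h0
  have hmin : IsMinimal ℤ_[p] (minimalAt (curveE ε m n) p) := by rw [minimalAt]; infer_instance
  rw [HasMultiplicativeReductionAt, hasMultiplicativeReduction_iff]
  refine ⟨hmin, lt_of_le_of_ne ?_ (mt h1.1 (not_not.2 h)), h2 h⟩
  rw [← integralModel_Δ_eq ℤ_[p] (minimalAt (curveE ε m n) p)]
  exact valuation_le_one _ _

end Reduction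

/-! ### Squarefree values of `δ_m` -/

end ThreeIsogeny

/-! ### The values `δ_m(n)` -/

namespace ThreeIsogeny

/-- The quadratic factor of `fullValue ε m n`. -/
def quadFactor (ε : ℤ) (m n : ℕ) : ℤ :=
  108 * (m + 24 * n : ℤ) ^ 2 - 18 * ε * (m + 24 * n) + 1

theorem fullValue_eq (ε : ℤ) (m n : ℕ) :
    fullValue ε m n = 2 * (m + 24 * n) * quadFactor ε m n := by
  simp only [fullValue, quadFactor]; ring

theorem quadFactor_pos (ε : ℤ) (hε : ε = 1 ∨ ε = -1) (m n : ℕ) : 0 < quadFactor ε m n := by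
  rw [quadFactor]
  have h : (0 : ℤ) ≤ m + 24 * n := by positivity
  rcases hε with rfl | rfl <;> nlinarith [sq_nonneg (6 * (m + 24 * n : ℤ) - 1)]

theorem odd_quadFactor (ε : ℤ) (m n : ℕ) : ¬ (2 : ℤ) ∣ quadFactor ε m n := by
  rintro ⟨u, hu⟩
  have : (2 : ℤ) ∣ 1 := ⟨u - 54 * (m + 24 * n : ℤ) ^ 2 + 9 * ε * (m + 24 * n), by
    rw [quadFactor] at hu; linear_combination hu⟩
  omega

theorem not_three_dvd_quadFactor (ε : ℤ) (m n : ℕ) : ¬ (3 : ℤ) ∣ quadFactor ε m n := by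
  rintro ⟨u, hu⟩
  have : (3 : ℤ) ∣ 1 := ⟨u - 36 * (m + 24 * n : ℤ) ^ 2 + 6 * ε * (m + 24 * n), by
    rw [quadFactor] at hu; linear_combination hu⟩
  omega

theorem not_three_dvd_of_admissible {m : ℕ} (hm : m ∈ admissible) : ¬ 3 ∣ m := by
  revert m; decide

theorem fullValue_pos (ε : ℤ) (hε : ε = 1 ∨ ε = -1) {m : ℕ} (hm : m ∈ admissible) (n : ℕ) :
    0 < fullValue ε m n := by
  have hm0 : 0 < m := Nat.pos_of_ne_zero fun h => not_three_dvd_of_admissible hm (h ▸ dvd_zero 3)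
  rw [fullValue_eq]
  exact mul_pos (by positivity) (quadFactor_pos ε hε m n)

theorem not_three_dvd_fullValue (ε : ℤ) {m : ℕ} (hm : m ∈ admissible) (n : ℕ) :
    ¬ (3 : ℤ) ∣ fullValue ε m n := by
  have h3 := not_three_dvd_of_admissible hm
  rw [fullValue_eq, Int.prime_three.dvd_mul]
  rintro (h | h)
  · omega
  · exact not_three_dvd_quadFactor ε m n h

theorem padicValInt_eq_iff_dvd {p : ℕ} (hp : p.Prime) {x : ℤ} (hx : x ≠ 0) (k : ℕ) :
    (p : ℤ) ^ k ∣ x ↔ k ≤ padicValInt p x := by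
  have := Fact.mk hp
  rw [padicValInt_dvd_iff]; simp [hx]

/-- At a prime dividing `fullValue ε m n`, its order is not divisible by `3` if `δ_m(n)` is
squarefree. -/
theorem not_three_dvd_padicValInt_fullValue (ε : ℤ) (hε : ε = 1 ∨ ε = -1) {m : ℕ}
    (hm : m ∈ admissible) (n : ℕ) (hsq : Squarefree (delta ε m n)) {p : ℕ} (hp : p.Prime)
    (hpd : (p : ℤ) ∣ fullValue ε m n) : ¬ 3 ∣ padicValInt p (fullValue ε m n) := by
  have h0 := (fullValue_pos ε hε hm n).ne'
  have hpi : Prime (p : ℤ) := Nat.prime_iff_prime_int.1 hp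
  have hdelta := two_pow_mul_delta ε hm n
  have hsq' : ¬ (p : ℤ) ^ 2 ∣ delta ε m n := fun h =>
    hpi.not_isUnit (hsq p (by rwa [← sq]))
  have h1 : 1 ≤ padicValInt p (fullValue ε m n) :=
    (padicValInt_eq_iff_dvd hp h0 1).1 (by rwa [pow_one])
  have hbound : ∀ k, ¬ (p : ℤ) ^ k ∣ fullValue ε m n → padicValInt p (fullValue ε m n) < k :=
    fun k hk => not_le.1 fun h => hk ((padicValInt_eq_iff_dvd hp h0 k).2 h)
  by_cases h2 : p = 2
  · subst h2
    by_cases h8 : m = 8 ∨ m = 16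
    · have he : twoExp m = 4 := by rcases h8 with rfl | rfl <;> decide
      rw [he] at hdelta
      have h4 := (padicValInt_eq_iff_dvd hp h0 4).1 ⟨_, hdelta.symm⟩
      -- Here F = 16δ and 4 ∤ δ, so the order at 2 is 4 or 5.
      have h6 := hbound 6 fun ⟨w, hw⟩ => hsq' ⟨w, by
        push_cast at hw ⊢
        linarith⟩
      omega
    -- 8 and 16 are the only admissible multiples of 4, so otherwise 8 ∤ F and the order at 2 is 1
    -- or 2.
    · have h3 := hbound 3 fun ⟨w, hw⟩ => by
        push_cast at hw
        have h4 : (4 : ℤ) ∣ (m + 24 * n) * quadFactor ε m n :=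
          ⟨w, by rw [fullValue_eq] at hw; linarith⟩
        have hc : IsCoprime (4 : ℤ) (quadFactor ε m n) := by
          have := ((Prime.coprime_iff_not_dvd Int.prime_two).2
            (odd_quadFactor ε m n)).pow_left (m := 2)
          norm_num at this; exact this
        have h4m := hc.dvd_of_dvd_mul_right h4
        have h4m' : 4 ∣ m := by omega
        revert h8 h4m' hm
        clear * -
        revert m
        decide
      omega
  · have hc : IsCoprime ((p : ℤ) ^ 2) (2 ^ twoExp m) :=
      IsCoprime.pow (Nat.isCoprime_iff_coprime.2 ((Nat.coprime_primes hp Nat.prime_two).2 h2))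
    have := hbound 2 fun h => hsq' (hc.dvd_of_dvd_mul_left (hdelta ▸ h))
    omega

/-- The linear factor is an + b = t/2^e with t = m + 24n; the remaining 2 in 2^(e+1) is the leading
factor of F. It is coprime to the quadratic factor, which is 1 modulo t. -/
theorem infinite_squarefree_delta_of_eq (ε : ℤ) (hε : ε = 1 ∨ ε = -1) {m : ℕ}
    (hm : m ∈ admissible) (e : ℕ) (a b : ℤ) (he : twoExp m = e + 1) (ha : 2 ^ e * a = 24)
    (hb : 2 ^ e * b = m) (hodd : Odd a ∨ 2 ∣ a ∧ ¬ 2 ∣ b) :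
    {n : ℕ | 0 < n ∧ Squarefree (delta ε m n)}.Infinite := by
  have hm3 := not_three_dvd_of_admissible hm
  have hm0 : 0 < m := Nat.pos_of_ne_zero fun h => hm3 (h ▸ dvd_zero 3)
  have hm23 : m ≤ 23 := by revert hm; clear * -; revert m; decide
  have hpe : (0 : ℤ) < 2 ^ e := by positivity
  have hlin : ∀ n : ℕ, 2 ^ e * (a * n + b) = (m + 24 * n : ℤ) := fun n => by
    linear_combination (n : ℤ) * ha + hb
  have hlinpos : ∀ n : ℕ, 0 < a * n + b := fun n =>
    pos_of_mul_pos_right (by rw [hlin]; positivity : 0 < 2 ^ e * (a * (n : ℤ) + b)) hpe.le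
  have hle : ∀ n : ℕ, a * n + b ≤ (m + 24 * n : ℤ) := fun n => by
    rw [← hlin]
    exact le_mul_of_one_le_left (hlinpos n).le (by omega)
  -- 4(108t² - 18εt + 1) = 3(12t - ε)² + 1 gives c = 12m - ε. Since t ≤ 24N, any K with K² ≥ 108·24²
  -- + 18·24 + 1 = 62641 serves.
  refine infinite_squarefree_linear_mul_quadratic a b (12 * m - ε) (fun n => a * n + b)
    (quadFactor ε m) (delta ε m) 271 (fun _ => rfl) (fun n => ?_) (fun n => ?_) (fun n => ?_)
    (fun p hp h5 => ?_) (fun n h3 => ?_) (hodd.imp_right fun h n h2 => ?_) (odd_quadFactor ε m)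
    (not_three_dvd_quadFactor ε m) hlinpos (quadFactor_pos ε hε m) (fun n N hnN => ?_)
    (fun n N hnN => ?_)
  · rcases hε with rfl | rfl <;> rw [quadFactor] <;> ring
  · have h := two_pow_mul_delta ε hm n
    rw [he, fullValue_eq, ← hlin] at h
    refine mul_left_cancel₀ (pow_ne_zero (e + 1) two_ne_zero) (h.trans ?_)
    ring
  · refine ⟨-(2 ^ e * (108 * (m + 24 * n : ℤ) - 18 * ε)), 1, ?_⟩
    rw [quadFactor]
    linear_combination -(108 * (m + 24 * n : ℤ) - 18 * ε) * hlin n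
  · have h2 : IsCoprime (p : ℤ) (2 : ℕ) :=
      Nat.isCoprime_iff_coprime.2 ((Nat.coprime_primes hp Nat.prime_two).2 (by omega))
    have h3 : IsCoprime (p : ℤ) (3 : ℕ) :=
      Nat.isCoprime_iff_coprime.2 ((Nat.coprime_primes hp Nat.prime_three).2 (by omega))
    have h24 : IsCoprime (p : ℤ) (2 ^ e * a) := by
      rw [ha]
      have := (h2.pow_right (n := 3)).mul_right h3
      norm_num at this; exact this
    exact h24.of_mul_right_right
  · have := h3.mul_left (2 ^ e)
    simp only [hlin] at this
    omega
  · exact h.2 ((Int.dvd_add_right (h.1.mul_right _)).1 h2)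
  · have h1 : (m + 24 * n : ℤ) ≤ 24 * N := by omega
    have hN : (1 : ℤ) ≤ N := by omega
    have := hle n
    push_cast
    nlinarith
  · have h1 : (m + 24 * n : ℤ) ≤ 24 * N := by omega
    have h0 : (1 : ℤ) ≤ m + 24 * n := by omega
    have h2 : (m + 24 * n : ℤ) ^ 2 ≤ (24 * N) ^ 2 := pow_le_pow_left₀ (by omega) h1 2
    rw [quadFactor]
    push_cast
    rcases hε with rfl | rfl <;> nlinarith

theorem infinite_squarefree_delta (ε : ℤ) (hε : ε = 1 ∨ ε = -1) {m : ℕ} (hm : m ∈ admissible) :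
    {n : ℕ | 0 < n ∧ Squarefree (delta ε m n)}.Infinite := by
  by_cases h1 : Odd m
  · refine infinite_squarefree_delta_of_eq ε hε hm 0 24 m (by simp [twoExp, h1]) (by norm_num)
      (by simp) (Or.inr ⟨by norm_num, ?_⟩)
    rw [Nat.odd_iff] at h1
    omega
  by_cases h2 : m = 8 ∨ m = 16
  · rcases h2 with rfl | rfl
    · exact infinite_squarefree_delta_of_eq ε hε hm 3 3 1 (by decide) (by norm_num) (by norm_num)
        (Or.inl (by decide))
    · exact infinite_squarefree_delta_of_eq ε hε hm 3 3 2 (by decide) (by norm_num) (by norm_num)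
        (Or.inl (by decide))
  · have h4 : ¬ 4 ∣ m := by revert h2 hm; clear * -; revert m; decide
    rw [Nat.odd_iff] at h1
    obtain ⟨b, rfl⟩ : 2 ∣ m := by omega
    refine infinite_squarefree_delta_of_eq ε hε hm 1 12 b ?_ (by norm_num) (by push_cast; ring)
      (Or.inr ⟨by norm_num, by omega⟩)
    rw [twoExp, if_neg (by rw [Nat.odd_iff]; omega), if_neg h2]

end ThreeIsogeny

/-! ### The quotient of `y² = x³ + (a x + b)²` by the subgroup generated by `(0, b)` -/

namespace ThreeIsogeny

section Isogeny

variable (a b : ℚ)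

theorem nonsingular_baseChange {F : Type*} [Field F] [Algebra ℚ F] (W : WeierstrassCurve ℚ)
    [W.IsElliptic] {x y : F} (h : (W.baseChange F).toAffine.Equation x y) :
    (W.baseChange F).toAffine.Nonsingular x y :=
  (Affine.equation_iff_nonsingular_of_Δ_ne_zero (by
    rw [WeierstrassCurve.baseChange, map_Δ, map_ne_zero]
    exact W.isUnit_Δ.ne_zero)).1 h

/-- The curve `y² = x³ + (a x + b)²`. -/
def isogenyDomain : WeierstrassCurve ℚ := ⟨0, a ^ 2, 0, 2 * a * b, b ^ 2⟩

/-- The curve `Y² = X³ - 3 (a X + B)²` with `B = 3 b - 4 a³ / 9` in the coordinates given by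
`X = 4 x + 1 / 3 + a²` and `Y = 8 y + 4 x`. -/
def isogenyCodomain : WeierstrassCurve ℚ :=
  ⟨1, 0, 0, (-6 * a * (3 * b - 4 * a ^ 3 / 9) - 6 * a ^ 2 * (1 / 3 + a ^ 2) +
    3 * (1 / 3 + a ^ 2) ^ 2) / 16,
  (-3 * (3 * b - 4 * a ^ 3 / 9) ^ 2 - 6 * a * (3 * b - 4 * a ^ 3 / 9) * (1 / 3 + a ^ 2) -
    3 * a ^ 2 * (1 / 3 + a ^ 2) ^ 2 + (1 / 3 + a ^ 2) ^ 3) / 64⟩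

theorem isogenyDomain_Δ : (isogenyDomain a b).Δ = 16 * b ^ 3 * (4 * a ^ 3 - 27 * b) := by
  simp only [isogenyDomain, WeierstrassCurve.Δ, b₂, b₄, b₆, b₈]; ring

theorem isogenyDomain_equation_iff {F : Type*} [Field F] [Algebra ℚ F] (x y : F) :
    ((isogenyDomain a b).baseChange F).toAffine.Equation x y ↔
      y ^ 2 = x ^ 3 + (algebraMap ℚ F a * x + algebraMap ℚ F b) ^ 2 := by
  rw [Affine.equation_iff]
  simp only [WeierstrassCurve.baseChange, map_a₁, map_a₂, map_a₃, map_a₄, map_a₆, isogenyDomain,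
    map_mul, map_pow, map_zero, map_ofNat]
  refine Eq.congr (by ring) (by ring)

theorem isogenyCodomain_equation {x y : QBar} (hx : x ≠ 0)
    (h : y ^ 2 = x ^ 3 + ((a : QBar) * x + b) ^ 2) :
    ((isogenyCodomain a b).baseChange QBar).toAffine.Equation
      (((x ^ 3 + 4 * (a ^ 2 / 3 * x ^ 2 + a * b * x + b ^ 2)) / x ^ 2 - (1 / 3 + a ^ 2)) / 4)
      ((y * (x ^ 3 - 4 * b * (a * x + 2 * b)) / x ^ 3 -
        (x ^ 3 + 4 * (a ^ 2 / 3 * x ^ 2 + a * b * x + b ^ 2)) / x ^ 2 + (1 / 3 + a ^ 2)) / 8) := by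
  rw [Affine.equation_iff]
  simp only [WeierstrassCurve.baseChange, map_a₁, map_a₂, map_a₃, map_a₄, map_a₆, isogenyCodomain,
    eq_ratCast]
  push_cast
  field_simp
  -- With g = x³ - 4b(ax + 2b), Y² - X³ + 3(aX + B)² = (g/x³)²(y² - x³ - (ax + b)²); the constant
  -- 2¹⁶·3⁷ comes from clearing denominators.
  linear_combination 143327232 * (x ^ 3 - 4 * b * (a * x + 2 * b)) ^ 2 * h

open scoped Classical in
/-- The quotient map on geometric points. -/
def isogenyMap [(isogenyCodomain a b).IsElliptic] :
    GeomPoint (isogenyDomain a b) → GeomPoint (isogenyCodomain a b)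
  | .zero => .zero
  | .some x y h =>
    if hx : x = 0 then .zero
    else .some _ _ (nonsingular_baseChange _ (isogenyCodomain_equation a b hx
      (by simpa only [eq_ratCast] using (isogenyDomain_equation_iff a b x y).1 h.1)))

open MvPolynomial

/-- The monomial `c x^i y^j z^k`. -/
def ternaryMonomial (c : ℚ) (i j k : ℕ) : MvPolynomial (Fin 3) ℚ :=
  C c * X 0 ^ i * X 1 ^ j * X 2 ^ k

theorem isHomogeneous_ternaryMonomial (c : ℚ) (i j k : ℕ) {d : ℕ} (h : i + j + k = d) :
    (ternaryMonomial c i j k).IsHomogeneous d := by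
  subst h
  have hX : ∀ (s : Fin 3) (l : ℕ), (X s ^ l : MvPolynomial (Fin 3) ℚ).IsHomogeneous l :=
    fun s l => isHomogeneous_X_pow s l
  simpa only [ternaryMonomial, zero_add] using (((isHomogeneous_C (Fin 3) c).mul (hX 0 i)).mul (hX 1 j)).mul (hX 2 k)

theorem aeval_ternaryMonomial (v : Fin 3 → QBar) (c : ℚ) (i j k : ℕ) :
    aeval v (ternaryMonomial c i j k) = c * v 0 ^ i * v 1 ^ j * v 2 ^ k := by
  simp [ternaryMonomial]

/-- Passage from the coordinates `X, Y` to the coordinates of `isogenyCodomain`. -/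
def codomainCoord (F : Fin 3 → MvPolynomial (Fin 3) ℚ) : Fin 3 → MvPolynomial (Fin 3) ℚ :=
  ![C (1 / 4) * (F 0 - C (1 / 3 + a ^ 2) * F 2),
    C (1 / 8) * (F 1 - F 0 + C (1 / 3 + a ^ 2) * F 2), F 2]

theorem isHomogeneous_codomainCoord {F : Fin 3 → MvPolynomial (Fin 3) ℚ} {d : ℕ}
    (hF : ∀ i, (F i).IsHomogeneous d) (i : Fin 3) : (codomainCoord a F i).IsHomogeneous d := by
  fin_cases i
  · exact ((hF 0).sub ((hF 2).C_mul _)).C_mul _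
  · exact (((hF 1).sub (hF 0)).add ((hF 2).C_mul _)).C_mul _
  · exact hF 2

/-- A representation of the quotient map away from the point at infinity. -/
def affineChart : Fin 3 → MvPolynomial (Fin 3) ℚ :=
  ![ternaryMonomial 1 4 0 0 + ternaryMonomial (4 / 3 * a ^ 2) 3 0 1 +
      ternaryMonomial (4 * a * b) 2 0 2 + ternaryMonomial (4 * b ^ 2) 1 0 3,
    ternaryMonomial 1 3 1 0 - ternaryMonomial (4 * a * b) 1 1 2 -
      ternaryMonomial (8 * b ^ 2) 0 1 3,
    ternaryMonomial 1 3 0 1]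

theorem isHomogeneous_affineChart (i : Fin 3) : (affineChart a b i).IsHomogeneous 4 := by
  have h := fun c i j k h => isHomogeneous_ternaryMonomial c i j k (d := 4) h
  fin_cases i
  · exact (((h _ _ _ _ rfl).add (h _ _ _ _ rfl)).add (h _ _ _ _ rfl)).add (h _ _ _ _ rfl)
  · exact ((h _ _ _ _ rfl).sub (h _ _ _ _ rfl)).sub (h _ _ _ _ rfl)
  · exact h _ _ _ _ rfl

/-- A representation of the quotient map near the point at infinity. -/
def infiniteChart : Fin 3 → MvPolynomial (Fin 3) ℚ :=
  ![ternaryMonomial 1 1 2 0 + ternaryMonomial (a ^ 2 / 3) 3 0 0 +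
      ternaryMonomial (2 * a * b) 2 0 1 + ternaryMonomial (3 * b ^ 2) 1 0 2,
    ternaryMonomial 1 0 3 0 - ternaryMonomial (a ^ 2) 2 1 0 -
      ternaryMonomial (6 * a * b) 1 1 1 - ternaryMonomial (9 * b ^ 2) 0 1 2,
    ternaryMonomial 1 0 2 1 - ternaryMonomial (a ^ 2) 2 0 1 -
      ternaryMonomial (2 * a * b) 1 0 2 - ternaryMonomial (b ^ 2) 0 0 3]

theorem isHomogeneous_infiniteChart (i : Fin 3) : (infiniteChart a b i).IsHomogeneous 3 := by
  have h := fun c i j k h => isHomogeneous_ternaryMonomial c i j k (d := 3) h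
  fin_cases i
  · exact (((h _ _ _ _ rfl).add (h _ _ _ _ rfl)).add (h _ _ _ _ rfl)).add (h _ _ _ _ rfl)
  · exact (((h _ _ _ _ rfl).sub (h _ _ _ _ rfl)).sub (h _ _ _ _ rfl)).sub (h _ _ _ _ rfl)
  · exact (((h _ _ _ _ rfl).sub (h _ _ _ _ rfl)).sub (h _ _ _ _ rfl)).sub (h _ _ _ _ rfl)

variable [(isogenyCodomain a b).IsElliptic]

theorem exists_aeval_affineChart_eq (Q : GeomPoint (isogenyDomain a b)) :
    ∃ c : QBar, ∀ i, aeval (homCoord Q) (codomainCoord a (affineChart a b) i) =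
      c * homCoord (isogenyMap a b Q) i := by
  rcases Q with _ | ⟨x, y, h⟩
  · refine ⟨0, fun i => ?_⟩
    fin_cases i <;> simp [codomainCoord, affineChart, aeval_ternaryMonomial, homCoord]
  · by_cases hx : x = 0
    -- At x = 0 only the middle form survives, with value -8b²y, and `codomainCoord` multiplies it
    -- by 1/8.
    · refine ⟨-(b : QBar) ^ 2 * y, fun i => ?_⟩
      fin_cases i <;> simp [codomainCoord, affineChart, aeval_ternaryMonomial, homCoord,
        isogenyMap, hx]
      ring
    · refine ⟨x ^ 3, fun i => ?_⟩
      fin_cases i <;> simp [codomainCoord, affineChart, aeval_ternaryMonomial, homCoord,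
        isogenyMap, hx] <;> field_simp <;> ring

/-- Modulo the curve equation x³ = z(y² - (ax + bz)²), the quartic forms of `affineChart` are z
times these cubics. Cancelling z leaves the same scalars at affine points and a nonzero value at
infinity. -/
theorem exists_aeval_infiniteChart_eq (Q : GeomPoint (isogenyDomain a b)) :
    ∃ c : QBar, ∀ i, aeval (homCoord Q) (codomainCoord a (infiniteChart a b) i) =
      c * homCoord (isogenyMap a b Q) i := by
  rcases Q with _ | ⟨x, y, h⟩
  · refine ⟨1 / 8, fun i => ?_⟩
    fin_cases i <;> simp [codomainCoord, infiniteChart, aeval_ternaryMonomial, homCoord, isogenyMap]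
  · have heq : y ^ 2 = x ^ 3 + ((a : QBar) * x + b) ^ 2 := by
      simpa only [eq_ratCast] using (isogenyDomain_equation_iff a b x y).1 h.1
    by_cases hx : x = 0
    · subst hx
      refine ⟨-(b : QBar) ^ 2 * y, fun i => ?_⟩
      fin_cases i <;> simp [codomainCoord, infiniteChart, aeval_ternaryMonomial, homCoord,
        isogenyMap]
      · right; linear_combination heq
      · linear_combination (y / 8 + (1 / 3 + (a : QBar) ^ 2) / 8) * heq
      · linear_combination heq
    · refine ⟨x ^ 3, fun i => ?_⟩
      fin_cases i <;> simp [codomainCoord, infiniteChart, aeval_ternaryMonomial, homCoord,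
        isogenyMap, hx]
      · field_simp
        linear_combination (3 * x - 1 - 3 * (a : QBar) ^ 2) * heq
      · field_simp
        linear_combination (3 * (a : QBar) ^ 2 - 3 * x + 3 * y + 1) * heq
      · linear_combination heq

theorem isMorphism_isogenyMap (hb : b ≠ 0) : IsMorphism (isogenyMap a b) := by
  have aux : ∀ (f : Fin 3 → MvPolynomial (Fin 3) ℚ),
      (∀ Q, ∃ c : QBar, ∀ i, aeval (homCoord Q) (f i) = c * homCoord (isogenyMap a b Q) i) →
      ∀ (Q : GeomPoint (isogenyDomain a b)) (i j : Fin 3),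
        aeval (homCoord Q) (f i) * homCoord (isogenyMap a b Q) j =
          aeval (homCoord Q) (f j) * homCoord (isogenyMap a b Q) i := by
    intro f hf Q i j
    obtain ⟨c, hc⟩ := hf Q
    rw [hc, hc]; ring
  have hb' : (b : QBar) ≠ 0 := by exact_mod_cast hb
  rintro (_ | ⟨x, y, h⟩)
  · refine ⟨3, _, isHomogeneous_codomainCoord a (isHomogeneous_infiniteChart a b), ⟨1, ?_⟩,
      aux _ (exists_aeval_infiniteChart_eq a b)⟩
    simp [codomainCoord, infiniteChart, aeval_ternaryMonomial, homCoord]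
  · refine ⟨4, _, isHomogeneous_codomainCoord a (isHomogeneous_affineChart a b), ?_,
      aux _ (exists_aeval_affineChart_eq a b)⟩
    by_cases hx : x = 0
    · subst hx
      have heq := (isogenyDomain_equation_iff a b 0 y).1 h.1
      have hy : y ≠ 0 := by
        rintro rfl
        exact hb' (by simpa using heq.symm)
      exact ⟨1, by simp [codomainCoord, affineChart, aeval_ternaryMonomial, homCoord, hb, hy]⟩
    · exact ⟨2, by simp [codomainCoord, affineChart, aeval_ternaryMonomial, homCoord, hx]⟩

theorem isogenyMap_eq_zero_iff (Q : GeomPoint (isogenyDomain a b)) :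
    isogenyMap a b Q = 0 ↔ Q = 0 ∨ ∃ y h, Q = .some 0 y h := by
  rcases Q with _ | ⟨x, y, h⟩
  · exact ⟨fun _ => Or.inl rfl, fun _ => rfl⟩
  · by_cases hx : x = 0
    · subst hx
      simp only [isogenyMap, Affine.Point.zero_def, dite_true, true_iff]
      exact Or.inr ⟨y, h, rfl⟩
    · simp [isogenyMap, hx, Affine.Point.zero_def]

end Isogeny

end ThreeIsogeny

namespace ThreeIsogeny

/-! ### The point (0, b) of order 3 and the kernel of the quotient map -/

section ThreeTorsion

variable (a b : ℚ)

theorem isogenyDomain_some_neg {F : Type*} [Field F] [Algebra ℚ F]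
    {x y : F} (h : ((isogenyDomain a b).baseChange F).toAffine.Nonsingular x y) :
    -(Affine.Point.some x y h) = .some x (-y) (by
      have := (Affine.nonsingular_neg ..).2 h
      simpa [Affine.negY, WeierstrassCurve.baseChange, isogenyDomain] using this) := by
  rw [Affine.Point.neg_some]
  simp [Affine.negY, WeierstrassCurve.baseChange, isogenyDomain]

/-- The tangent y = ax + b at (0, b) meets the curve where x³ = 0, so the point is a flex and 2P =
-P. -/
theorem addOrderOf_some_zero {F : Type*} [Field F] [Algebra ℚ F] [DecidableEq F] (hb : b ≠ 0)
    {y : F} (hy : y = algebraMap ℚ F b)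
    (h : ((isogenyDomain a b).baseChange F).toAffine.Nonsingular 0 y) :
    addOrderOf (Affine.Point.some 0 y h) = 3 := by
  have : CharZero F := algebraRat.charZero F
  have hb' : y ≠ 0 := by rw [hy]; exact (map_ne_zero _).2 hb
  have hneg : ((isogenyDomain a b).baseChange F).toAffine.negY 0 y = -y := by
    simp [Affine.negY, WeierstrassCurve.baseChange, isogenyDomain]
  have hne : y ≠ ((isogenyDomain a b).baseChange F).toAffine.negY 0 y := by
    rw [hneg]
    exact fun h => hb' (self_eq_neg.1 h)
  have hslope : ((isogenyDomain a b).baseChange F).toAffine.slope 0 0 y y = algebraMap ℚ F a := by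
    rw [Affine.slope_of_Y_ne rfl hne, hneg, div_eq_iff (by simpa [← two_mul] using hb'), hy]
    simp [WeierstrassCurve.baseChange, isogenyDomain]
    ring
  have htwo : Affine.Point.some 0 y h + Affine.Point.some 0 y h = -Affine.Point.some 0 y h := by
    rw [Affine.Point.add_self_of_Y_ne hne, isogenyDomain_some_neg, Affine.Point.some.injEq, hslope]
    simp [Affine.addX, Affine.addY, Affine.negAddY, Affine.negY, WeierstrassCurve.baseChange,
      isogenyDomain]
  refine addOrderOf_eq_prime (p := 3) ?_ (Affine.Point.some_ne_zero h)
  rw [succ_nsmul, two_nsmul, htwo, neg_add_cancel]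

theorem isogenyCodomain_isQuotientByRationalThreeTorsion [(isogenyCodomain a b).IsElliptic]
    (hb : b ≠ 0) (hab : 4 * a ^ 3 - 27 * b ≠ 0) :
    IsQuotientByRationalThreeTorsion (isogenyCodomain a b) := by
  classical
  have hell : (isogenyDomain a b).IsElliptic := by
    rw [isElliptic_iff, isogenyDomain_Δ, isUnit_iff_ne_zero]
    positivity
  have hP : ((isogenyDomain a b).baseChange ℚ).toAffine.Nonsingular 0 b :=
    nonsingular_baseChange _ ((isogenyDomain_equation_iff a b 0 b).2 (by simp))
  refine ⟨isogenyDomain a b, .some 0 b hP, addOrderOf_some_zero a b hb rfl hP, hell, ‹_›,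
    isogenyMap a b, isMorphism_isogenyMap a b hb, rfl, fun Q => ?_⟩
  rw [isogenyMap_eq_zero_iff]
  have hPbar : ((isogenyDomain a b).baseChange QBar).toAffine.Nonsingular 0 (algebraMap ℚ QBar b) :=
    nonsingular_baseChange _ ((isogenyDomain_equation_iff a b 0 _).2 (by simp))
  have hmap : Affine.Point.baseChange ℚ QBar (.some 0 b hP : RatPoint (isogenyDomain a b)) =
      .some 0 (algebraMap ℚ QBar b) hPbar := by
    rw [Affine.Point.map_some]
    simp
  rw [hmap]
  have hord := addOrderOf_some_zero a b hb rfl hPbar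
  constructor
  · rintro (rfl | ⟨y, h, rfl⟩)
    · exact zero_mem _
    · have heq := (isogenyDomain_equation_iff a b 0 y).1 h.1
      -- The affine points over x = 0 are (0, ±b), that is ±P.
      have : y ^ 2 = algebraMap ℚ QBar b ^ 2 := by simpa using heq
      rcases sq_eq_sq_iff_eq_or_eq_neg.1 this with rfl | rfl
      · exact AddSubgroup.mem_zmultiples _
      · have := neg_mem (AddSubgroup.mem_zmultiples (Affine.Point.some 0 _ hPbar))
        rwa [isogenyDomain_some_neg] at this
  · intro hQ
    obtain ⟨k, rfl⟩ := AddSubgroup.mem_zmultiples_iff.1 hQ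
    have hneg : (2 : ℤ) • Affine.Point.some 0 _ hPbar = -Affine.Point.some 0 _ hPbar := by
      have h3 := addOrderOf_nsmul_eq_zero (Affine.Point.some 0 _ hPbar)
      rw [hord, succ_nsmul, add_eq_zero_iff_eq_neg] at h3
      exact_mod_cast h3
    rw [← mod_addOrderOf_zsmul, hord]
    have hk : k % (3 : ℕ) = 0 ∨ k % (3 : ℕ) = 1 ∨ k % (3 : ℕ) = 2 := by omega
    rcases hk with hk | hk | hk <;> rw [hk]
    · exact Or.inl (zero_zsmul _)
    · exact Or.inr ⟨_, hPbar, one_zsmul _⟩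
    · rw [hneg, isogenyDomain_some_neg]
      exact Or.inr ⟨_, _, rfl⟩

end ThreeTorsion

/-- The value of b is forced by 3b - 4A³/9 = 4ε/9. -/
theorem curveE_eq_isogenyCodomain (ε : ℤ) (m n : ℕ) :
    curveE ε m n =
      isogenyCodomain (coeffA ε m n) (4 * (coeffA ε m n ^ 3 + ε) / 27) := by
  simp only [curveE, isogenyCodomain, coeffH, coeffJ, coeffR, coeffB, coeffD,
    WeierstrassCurve.mk.injEq, true_and]
  constructor <;> ring

end ThreeIsogeny

end

theorem proposition3p4 (ε : ℤ) (hε : ε = 1 ∨ ε = -1) (m : ℕ) (hm : m ∈ ThreeIsogeny.admissible) :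
    {n : ℕ | 0 < n ∧ Squarefree (ThreeIsogeny.delta ε m n)}.Infinite ∧
    ∀ n : ℕ, Squarefree (ThreeIsogeny.delta ε m n) →
      (ThreeIsogeny.curveE ε m n).IsElliptic ∧
      ThreeIsogeny.IsQuotientByRationalThreeTorsion (ThreeIsogeny.curveE ε m n) ∧
      ThreeIsogeny.IsSemistable (ThreeIsogeny.curveE ε m n) ∧
      ThreeIsogeny.HasGoodReductionAt (ThreeIsogeny.curveE ε m n) 3 ∧
      ∀ (p : ℕ) [Fact p.Prime], ¬ ThreeIsogeny.HasGoodReductionAt (ThreeIsogeny.curveE ε m n) p →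
        ¬ (3 : ℤ) ∣ ThreeIsogeny.ordDisc (ThreeIsogeny.curveE ε m n) p := by
  open ThreeIsogeny in
  refine ⟨infinite_squarefree_delta ε hε hm, fun n hsq => ?_⟩
  have h0 := (fullValue_pos ε hε hm n).ne'
  have hε0 : ε ≠ 0 := by rcases hε with rfl | rfl <;> norm_num
  have hell : (curveE ε m n).IsElliptic := by
    rw [isElliptic_iff, curveE_Δ ε hε, isUnit_iff_ne_zero]
    exact_mod_cast mul_ne_zero (neg_ne_zero.2 hε0) h0
  refine ⟨hell, ?_, isSemistable_curveE ε hε m n h0,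
    (hasGoodReductionAt_curveE_iff ε hε m n 3 h0).2 (not_three_dvd_fullValue ε hm n),
    fun p _ hbad => ?_⟩
  · have hE := curveE_eq_isogenyCodomain ε m n
    rw [hE] at hell ⊢
    refine isogenyCodomain_isQuotientByRationalThreeTorsion _ _ ?_ ?_
    · have hA : coeffA ε m n ^ 3 + ε = ((27 * fullValue ε m n : ℤ) : ℚ) := by
        rcases hε with rfl | rfl <;> simp only [fullValue, coeffA] <;> push_cast <;> ring
      rw [hA]
      have : ((27 * fullValue ε m n : ℤ) : ℚ) ≠ 0 := by exact_mod_cast mul_ne_zero (by norm_num) h0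
      positivity
    -- For this b, 4A³ - 27b = -4ε.
    · have : (ε : ℚ) ≠ 0 := by exact_mod_cast hε0
      intro h
      exact this (by linear_combination -h / 4)
  · rw [hasGoodReductionAt_curveE_iff ε hε m n p h0, not_not] at hbad
    rw [(minimalAt_curveE ε hε m n p h0).2.2]
    exact_mod_cast not_three_dvd_padicValInt_fullValue ε hε hm n hsq Fact.out hbad
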